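/- Let $G$ be one of the complex classical groups $\mathrm{Sp}_{2n}$ ($n\ge 2$), $\mathrm{SO}_{2n+1}$ ($n\ge 2$) or $\mathrm{SO}_{2n}$ ($n\ge 4$), realized as $G=\{g\in \mathrm{SL}_N(\mathbb{C}) : (g^{t})^{-1}=EgE^{-1}\}$ with $N=2n,\,2n+1,\,2n$ respectively. Here, for $\mathrm{SO}_{2n}$, $E$ is the antidiagonal matrix with all antidiagonal entries $1$; for $\mathrm{SO}_{2n+1}$ it is the antidiagonal matrix with all antidiagonal entries $1$ except the $(n+1,n+1)$ entry, which is $2$; and for $\mathrm{Sp}_{2n}$ it is $\begin{pmatrix}0&-J_n\\ J_n&0\end{pmatrix}$, where $J_n$ is the $n\times n$ antidiagonal matrix with all antidiagonal entries $1$. Let $T\subset G$ be the maximal torus of diagonal matrices in $G$, let $W=N_G(T)/T$ be the Weyl group, and let $\mathfrak{g}=\{A\in \mathrm{End}(\mathbb{C}^N): A^tE+EA=0\}$ and $\mathfrak{t}\subset\mathfrak{g}$ (the diagonal matrices in $\mathfrak{g}$) be the Lie algebras of $G$ and $T$. With respect to the trace form $\langle A,B\rangle=\mathrm{tr}(AB)$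 one has $\mathrm{End}(\mathbb{C}^N)=\mathfrak{g}\oplus\mathfrak{g}^{\perp}$. Let $\theta:G\to\mathfrak{g}$ be the Springer morphism of the defining representation, that is, the inclusion $G\subset \mathrm{End}(\mathbb{C}^N)$ followed by the projection onto $\mathfrak{g}$ along $\mathfrak{g}^\perp$. It maps $T$ to $\mathfrak{t}$. Let $$\mathrm{Rep}^{\mathbb{C}}_{\mathrm{poly}}(G)=\{\,p\circ\theta|_T : p\in\mathbb{C}[\mathfrak{t}]^{W}\,\}$$ be the algebra of functions on $T$ that is the image of the $W$-invariant polynomial functions on $\mathfrak{t}$ under $(\theta|_T)^*$, and identify the class of a representation of $G$ with its character restricted to $T$. Then no non-trivial irreducible (finite-dimensional, rational) representation $V(\lambda)$ of $G$ (that is, with highest weight $\lambda\neq 0$) belongs to $\mathrm{Rep}^{\mathbb{C}}_{\mathrm{poly}}(G)$. -/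

import Mathlib

namespace ClassicalGroups

open Matrix

/-- The three families of classical groups: `B` stands for `SO_{2n+1}`, `C` for `Sp_{2n}`,
`D` for `SO_{2n}`. -/
inductive Family
  | B
  | C
  | D

/-- The dimension of the defining representation. -/
def Family.dim : Family → ℕ → ℕ
  | .B, n => 2 * n + 1
  | .C, n => 2 * n
  | .D, n => 2 * n

/-- The nonzero entry in row `i` of the antidiagonal matrix of the defining bilinear form
(rows are numbered from `0`): for `D` all entries are `1`; for `B` the middle entry is `2` and the
others are `1`; for `C` the upper half is `-1` and the lower half is `1`. -/
def Family.entry : (X : Family) → (n : ℕ) → Fin (X.dim n) → ℂ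
  | .B, n => fun i => if i.val = n then 2 else 1
  | .C, n => fun i => if i.val < n then -1 else 1
  | .D, _ => fun _ => 1

/-- The matrix `E` of the bilinear form: antidiagonal, symmetric for `B` and `D` and alternating
for `C`. -/
def form (X : Family) (n : ℕ) : Matrix (Fin (X.dim n)) (Fin (X.dim n)) ℂ :=
  fun i j => if j = i.rev then X.entry n i else 0

/-- The classical group `G = {g ∈ SL_N : gᵀ E g = E}`, equivalently `(gᵀ)⁻¹ = E g E⁻¹`. -/
def G (X : Family) (n : ℕ) : Subgroup (Matrix.SpecialLinearGroup (Fin (X.dim n)) ℂ) where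
  carrier := {g | g.1ᵀ * form X n * g.1 = form X n}
  one_mem' := by simp
  mul_mem' := by
    intro a b ha hb
    change (a.1 * b.1)ᵀ * form X n * (a.1 * b.1) = form X n
    change a.1ᵀ * form X n * a.1 = form X n at ha
    change b.1ᵀ * form X n * b.1 = form X n at hb
    calc _ = b.1ᵀ * (a.1ᵀ * form X n * a.1) * b.1 := by
          rw [transpose_mul]; simp only [mul_assoc]
      _ = _ := by rw [ha, hb]
  inv_mem' := by
    intro a ha
    change (a⁻¹).1ᵀ * form X n * (a⁻¹).1 = form X n
    change a.1ᵀ * form X n * a.1 = form X n at ha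
    have h1 : a.1 * (a⁻¹).1 = 1 := congrArg Subtype.val (mul_inv_cancel a)
    have h2 : (a⁻¹).1ᵀ * a.1ᵀ = 1 := by rw [← transpose_mul, h1, transpose_one]
    calc _ = (a⁻¹).1ᵀ * (a.1ᵀ * form X n * a.1) * (a⁻¹).1 := by rw [ha]
      _ = ((a⁻¹).1ᵀ * a.1ᵀ) * form X n * (a.1 * (a⁻¹).1) := by simp only [mul_assoc]
      _ = _ := by rw [h1, h2, one_mul, mul_one]

/-- The underlying matrix of an element of `G`. -/
def mat {X : Family} {n : ℕ} (g : G X n) : Matrix (Fin (X.dim n)) (Fin (X.dim n)) ℂ :=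
  g.1.1

/-- The maximal torus `T` of `G`: the diagonal matrices in `G`, that is
`diag (t₁, …, tₙ, tₙ⁻¹, …, t₁⁻¹)` for `C`, `D` and
`diag (t₁, …, tₙ, 1, tₙ⁻¹, …, t₁⁻¹)` for `B`. -/
def torus (X : Family) (n : ℕ) : Subgroup (G X n) where
  carrier := {g | (mat g).IsDiag}
  one_mem' := isDiag_one
  mul_mem' := by
    intro a b ha hb
    change (mat a * mat b).IsDiag
    change (mat a).IsDiag at ha
    change (mat b).IsDiag at hb
    rw [← ha.diagonal_diag, ← hb.diagonal_diag, diagonal_mul_diagonal]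
    exact isDiag_diagonal _
  inv_mem' := by
    intro a ha
    change (mat a).IsDiag at ha
    change (mat a).adjugate.IsDiag
    rw [← ha.diagonal_diag, adjugate_diagonal]
    exact isDiag_diagonal _

/-- The Lie algebra `𝔤 = {A : Aᵀ E + E A = 0}` of `G`, inside `End (ℂ^N)`. -/
noncomputable def lieAlg (X : Family) (n : ℕ) :
    Submodule ℂ (Matrix (Fin (X.dim n)) (Fin (X.dim n)) ℂ) :=
  skewAdjointMatricesSubmodule (form X n)

/-- The Lie algebra `𝔱` of `T`: the diagonal matrices in `𝔤`. -/
def cartan (X : Family) (n : ℕ) : Submodule ℂ (Matrix (Fin (X.dim n)) (Fin (X.dim n)) ℂ) where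
  carrier := {A | A ∈ lieAlg X n ∧ A.IsDiag}
  zero_mem' := ⟨Submodule.zero_mem _, isDiag_zero⟩
  add_mem' := fun ha hb => ⟨Submodule.add_mem _ ha.1 hb.1, ha.2.add hb.2⟩
  smul_mem' := fun c _ ha => ⟨Submodule.smul_mem _ c ha.1, ha.2.smul c⟩

/-- The trace form `⟨A, B⟩ = tr (A B)` on `End (ℂ^N)`. -/
noncomputable def traceForm (X : Family) (n : ℕ) :
    LinearMap.BilinForm ℂ (Matrix (Fin (X.dim n)) (Fin (X.dim n)) ℂ) :=
  (LinearMap.mul ℂ (Matrix (Fin (X.dim n)) (Fin (X.dim n)) ℂ)).compr₂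
    (traceLinearMap (Fin (X.dim n)) ℂ ℂ)

theorem traceForm_apply (X : Family) (n : ℕ) (A B : Matrix (Fin (X.dim n)) (Fin (X.dim n)) ℂ) :
    traceForm X n A B = trace (A * B) := rfl

/-- The inverse of `E`. -/
noncomputable def formInv (X : Family) (n : ℕ) : Matrix (Fin (X.dim n)) (Fin (X.dim n)) ℂ :=
  fun i j => if j = i.rev then (X.entry n j)⁻¹ else 0

theorem entry_ne_zero (X : Family) (n : ℕ) (i : Fin (X.dim n)) : X.entry n i ≠ 0 := by
  cases X <;> simp only [Family.entry] <;> (try split_ifs) <;> norm_num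

theorem form_mul_formInv (X : Family) (n : ℕ) : form X n * formInv X n = 1 := by
  ext i j
  simp only [mul_apply, form, formInv, ite_mul, zero_mul, Finset.sum_ite_eq',
    Finset.mem_univ, if_true, Fin.rev_rev, one_apply]
  by_cases h : i = j
  · subst h; simp [entry_ne_zero]
  · simp [h, Ne.symm h]

theorem formInv_mul_form (X : Family) (n : ℕ) : formInv X n * form X n = 1 :=
  mul_eq_one_comm.mp (form_mul_formInv X n)

theorem form_transpose (X : Family) (n : ℕ) :
    (form X n)ᵀ = form X n ∨ (form X n)ᵀ = -form X n := by
  have key : ∀ ε : ℂ, (∀ i, X.entry n (Fin.rev i) = ε * X.entry n i) →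
      (form X n)ᵀ = ε • form X n := by
    intro ε h
    ext i j
    change (if i = j.rev then X.entry n j else 0) = ε * (if j = i.rev then X.entry n i else 0)
    by_cases hij : j = i.rev
    · subst hij; simp [h]
    · have : i ≠ j.rev := fun h' => hij (by rw [h', Fin.rev_rev])
      simp [hij, this]
  cases X with
  | B =>
    left
    have := key 1 (fun i => by
      have hi : i.val < 2 * n + 1 := i.isLt
      have hr : (Fin.rev i).val = 2 * n + 1 - (i.val + 1) := Fin.val_rev i
      have : (Fin.rev i).val = n ↔ i.val = n := by omega
      simp only [Family.entry, this, one_mul])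
    simpa using this
  | C =>
    right
    have := key (-1) (fun i => by
      have hi : i.val < 2 * n := i.isLt
      have hr : (Fin.rev i).val = 2 * n - (i.val + 1) := Fin.val_rev i
      have : (Fin.rev i).val < n ↔ ¬ i.val < n := by omega
      simp only [Family.entry, this]
      split_ifs <;> simp_all)
    simpa using this
  | D =>
    left
    have := key 1 (fun i => by simp [Family.entry])
    simpa using this

theorem mem_lieAlg {X : Family} {n : ℕ} {A : Matrix (Fin (X.dim n)) (Fin (X.dim n)) ℂ} :
    A ∈ lieAlg X n ↔ Aᵀ * form X n = -(form X n * A) := by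
  rw [lieAlg, mem_skewAdjointMatricesSubmodule, Matrix.IsSkewAdjoint, Matrix.IsAdjointPair,
    mul_neg]

/-- The adjoint `E⁻¹ Aᵀ E` of a matrix `A`. -/
noncomputable def adj {X : Family} {n : ℕ} (A : Matrix (Fin (X.dim n)) (Fin (X.dim n)) ℂ) :
    Matrix (Fin (X.dim n)) (Fin (X.dim n)) ℂ :=
  formInv X n * Aᵀ * form X n

theorem sub_adj_mem {X : Family} {n : ℕ} (A : Matrix (Fin (X.dim n)) (Fin (X.dim n)) ℂ) :
    A - adj A ∈ lieAlg X n := by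
  have e1 := form_mul_formInv X n
  have e3 : (adj A)ᵀ * form X n = form X n * A := by
    have h1 : (form X n)ᵀ * A * ((formInv X n)ᵀ * form X n) = form X n * A := by
      have h2 : (formInv X n)ᵀ * (form X n)ᵀ = 1 := by rw [← transpose_mul, e1, transpose_one]
      rcases form_transpose X n with h | h
      · rw [h] at h2 ⊢; rw [h2, mul_one]
      · rw [h, mul_neg] at h2
        rw [h, ← neg_eq_iff_eq_neg.mpr h2.symm]
        simp
    rw [adj, transpose_mul, transpose_mul, transpose_transpose, ← h1]
    simp only [mul_assoc]
  rw [mem_lieAlg, transpose_sub, sub_mul, e3, adj, mul_sub, ← mul_assoc, ← mul_assoc, e1, one_mul]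
  abel

theorem trace_adj_mul {X : Family} {n : ℕ} (A Y : Matrix (Fin (X.dim n)) (Fin (X.dim n)) ℂ)
    (hY : Y ∈ lieAlg X n) : trace (adj A * Y) = -trace (A * Y) := by
  rw [mem_lieAlg] at hY
  have h : form X n * Y = -(Yᵀ * form X n) := by rw [hY, neg_neg]
  calc trace (adj A * Y) = trace (formInv X n * (Aᵀ * (form X n * Y))) := by
        rw [adj]; simp only [mul_assoc]
    _ = trace ((Aᵀ * (form X n * Y)) * formInv X n) := trace_mul_comm _ _
    _ = -trace (Aᵀ * Yᵀ * (form X n * formInv X n)) := by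
        rw [h, ← trace_neg]; simp only [mul_assoc, mul_neg, neg_mul]
    _ = -trace (A * Y) := by
        rw [form_mul_formInv, mul_one, ← transpose_mul, trace_transpose, trace_mul_comm]

theorem add_adj_mem {X : Family} {n : ℕ} (A : Matrix (Fin (X.dim n)) (Fin (X.dim n)) ℂ) :
    A + adj A ∈ (traceForm X n).orthogonal (lieAlg X n) := by
  rw [LinearMap.BilinForm.mem_orthogonal_iff]
  intro Y hY
  change traceForm X n Y (A + adj A) = 0
  rw [traceForm_apply, trace_mul_comm, add_mul, trace_add, trace_adj_mul A Y hY, add_neg_cancel]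

theorem half_add_half {X : Family} {n : ℕ} (A : Matrix (Fin (X.dim n)) (Fin (X.dim n)) ℂ) :
    (1 / 2 : ℂ) • (A - adj A) + (1 / 2 : ℂ) • (A + adj A) = A := by
  rw [← smul_add, sub_add_add_cancel, ← two_smul ℂ, smul_smul]; norm_num

/-- `End (ℂ^N) = 𝔤 ⊕ 𝔤^⊥`, the complement being taken for the trace form. -/
theorem isCompl_lieAlg (X : Family) (n : ℕ) :
    IsCompl (lieAlg X n) ((traceForm X n).orthogonal (lieAlg X n)) := by
  constructor
  · rw [Submodule.disjoint_def]
    intro Y hY hY'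
    rw [LinearMap.BilinForm.mem_orthogonal_iff] at hY'
    rw [ext_iff_trace_mul_left]
    intro A
    have h1 : traceForm X n (A - adj A) Y = 0 := hY' _ (sub_adj_mem A)
    rw [traceForm_apply, sub_mul, trace_sub, trace_adj_mul A Y hY] at h1
    rw [mul_zero, trace_zero]
    linear_combination h1 / 2
  · rw [codisjoint_iff, eq_top_iff]
    intro A _
    rw [Submodule.mem_sup]
    exact ⟨_, Submodule.smul_mem _ _ (sub_adj_mem A), _, Submodule.smul_mem _ _ (add_adj_mem A),
      half_add_half A⟩

/-- The Springer morphism `θ : G → 𝔤` of the defining representation: the inclusion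
`G ⊆ End (ℂ^N)` followed by the projection of `End (ℂ^N) = 𝔤 ⊕ 𝔤^⊥` onto `𝔤`. -/
noncomputable def springer (X : Family) (n : ℕ) (g : G X n) : lieAlg X n :=
  (lieAlg X n).projectionOnto ((traceForm X n).orthogonal (lieAlg X n)) (isCompl_lieAlg X n) (mat g)

theorem springer_eq {X : Family} {n : ℕ} (g : G X n) :
    (springer X n g : Matrix (Fin (X.dim n)) (Fin (X.dim n)) ℂ) =
      (1 / 2 : ℂ) • (mat g - adj (mat g)) := by
  have h1 := Submodule.projectionOnto_apply_left (isCompl_lieAlg X n)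
    ⟨_, Submodule.smul_mem _ (1 / 2 : ℂ) (sub_adj_mem (mat g))⟩
  have h2 := Submodule.projectionOnto_apply_right (isCompl_lieAlg X n)
    ⟨_, Submodule.smul_mem _ (1 / 2 : ℂ) (add_adj_mem (mat g))⟩
  rw [springer]
  conv_lhs => rw [← half_add_half (mat g), map_add, h1, h2, add_zero]

theorem adj_isDiag {X : Family} {n : ℕ} {A : Matrix (Fin (X.dim n)) (Fin (X.dim n)) ℂ}
    (hA : A.IsDiag) : (adj A).IsDiag := by
  intro i j hij
  rw [adj, ← hA.diagonal_diag, diagonal_transpose, mul_apply]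
  refine Finset.sum_eq_zero fun k _ => ?_
  rw [mul_diagonal]
  by_cases h1 : k = i.rev
  · have h2 : j ≠ k.rev := by
      rw [h1, Fin.rev_rev]; exact hij.symm
    rw [show form X n k j = 0 from if_neg h2, mul_zero]
  · rw [show formInv X n i k = 0 from if_neg h1, zero_mul, zero_mul]

/-- The restriction `θ|_T : T → 𝔱` of the Springer morphism to the maximal torus. -/
noncomputable def springerTorus (X : Family) (n : ℕ) (t : torus X n) : cartan X n :=
  ⟨springer X n t.1, (springer X n t.1).2, by
    rw [springer_eq]; exact (t.2.sub (adj_isDiag t.2)).smul _⟩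

/-- The algebra of regular functions on the subvariety of the space of matrices that is the image
of `c : S → End (ℂ^N)`: the polynomials in the matrix entries. (No inverse of the determinant is
needed for a closed subgroup of `SL_N`.) -/
def regular {X : Family} {n : ℕ} {S : Type*} (c : S → Matrix (Fin (X.dim n)) (Fin (X.dim n)) ℂ) :
    Subalgebra ℂ (S → ℂ) :=
  Algebra.adjoin ℂ {f | ∃ i j, f = fun s => c s i j}

/-- The algebra `ℂ[𝔱]^W` of polynomial functions on `𝔱` that are invariant under the Weyl group
`W = N_G(T) / T`, which acts on `𝔱` by conjugation with elements `w` of `N_G(T)`. -/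
def invariants (X : Family) (n : ℕ) : Subalgebra ℂ (cartan X n → ℂ) :=
  regular (X := X) (n := n) (fun x : cartan X n => x.1) ⊓
    { carrier := {p | ∀ w ∈ Subgroup.normalizer (torus X n : Set (G X n)), ∀ x y : cartan X n,
        y.1 = mat w * x.1 * mat (w⁻¹) → p y = p x}
      mul_mem' := fun ha hb w hw x y h =>
        congrArg₂ (· * ·) (ha w hw x y h) (hb w hw x y h)
      add_mem' := fun ha hb w hw x y h =>
        congrArg₂ (· + ·) (ha w hw x y h) (hb w hw x y h)
      algebraMap_mem' := fun _ _ _ _ _ _ => rfl }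

/-- The comorphism `(θ|_T)^*`, which takes a function `p` on `𝔱` to the function `p ∘ θ|_T` on
`T`. -/
noncomputable def comorphism (X : Family) (n : ℕ) : (cartan X n → ℂ) →ₐ[ℂ] (torus X n → ℂ) :=
  AlgHom.pi fun t => Pi.evalAlgHom ℂ _ (springerTorus X n t)

/-- The ring `Rep^ℂ_poly(G)`, as an algebra of functions on `T` (a virtual character is identified
with its restriction to `T`): the image of `ℂ[𝔱]^W` under `(θ|_T)^*`. -/
noncomputable def RepPoly (X : Family) (n : ℕ) : Subalgebra ℂ (torus X n → ℂ) :=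
  (invariants X n).map (comorphism X n)

/-- A representation of the algebraic group `G` on a finite-dimensional space is rational if its
matrix coefficients are regular functions on `G`. -/
def IsRational {X : Family} {n : ℕ} {V : Type*} [AddCommGroup V] [Module ℂ V]
    (ρ : Representation ℂ (G X n) V) : Prop :=
  ∀ (φ : Module.Dual ℂ V) (v : V),
    (fun g => φ (ρ g v)) ∈ regular (X := X) (n := n) (fun g : G X n => mat g)

/-- The character of a representation of `G`, restricted to `T`. -/
noncomputable def torusCharacter {X : Family} {n : ℕ} {V : Type*} [AddCommGroup V] [Module ℂ V]
    (ρ : Representation ℂ (G X n) V) : torus X n → ℂ :=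
  fun t => ρ.character (t : G X n)

end ClassicalGroups

/-! On `G` the adjoint with respect to the form is the inverse, so `θ(g) = (g - g⁻¹) / 2`, and `θ`
vanishes at every `t ∈ T` with `t² = 1`, including `t = 1` (`springerTorus_eq_zero`). A character of
the form `p ∘ θ` therefore takes the value `p(0) = dim V` at each such `t`. Since `ρ(t)` is an
involution whose trace is `dim V`, it is the identity (`apply_eq_one_of_mem_RepPoly`).

So `ker ρ` is a normal subgroup containing each element of `T` that negates one pair of opposite
coordinates and fixes the others. Such a subgroup is all of `G` (`eq_top_of_signElement_mem`), and
`ρ` is trivial. This last fact is proved without coordinates. In the orthogonal case the given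
element is a product of two orthogonal reflections; its conjugates yield all products of two
reflections, and these generate the special orthogonal group. In the symplectic case commutators
with the given element yield transvections, and these generate the symplectic group. -/

namespace LinearMap.BilinForm

open Module

variable {V : Type*} [AddCommGroup V] [Module ℂ V]

/-- The group of linear automorphisms preserving a bilinear form. -/
def isometryGroup (B : LinearMap.BilinForm ℂ V) : Subgroup (V ≃ₗ[ℂ] V) where
  carrier := {g | ∀ x y, B (g x) (g y) = B x y}
  one_mem' := fun _ _ => rfl
  mul_mem' := fun {a b} ha hb x y => (ha (b x) (b y)).trans (hb x y)
  inv_mem' := fun {a} ha x y => by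
    have h := ha (a⁻¹ x) (a⁻¹ y)
    rwa [← LinearEquiv.mul_apply, ← LinearEquiv.mul_apply, mul_inv_cancel, eq_comm] at h

/-- The group of isometries of determinant one of a bilinear form. -/
noncomputable def specialIsometryGroup (B : LinearMap.BilinForm ℂ V) : Subgroup (V ≃ₗ[ℂ] V) :=
  isometryGroup B ⊓ (LinearEquiv.det (R := ℂ) (M := V)).ker

/-! ### Orthogonal groups: generation by reflections, normal subgroups containing a half-turn. -/

section Symmetric

variable {B : LinearMap.BilinForm ℂ V}

open Classical in
/-- The orthogonal reflection in an anisotropic vector (and the identity for isotropic ones). -/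
noncomputable def orthReflection (B : LinearMap.BilinForm ℂ V) (v : V) : V ≃ₗ[ℂ] V :=
  if h : B v v ≠ 0 then
    Module.reflection (x := v) (f := (2 / B v v) • B v) (by simp [h])
  else 1

theorem orthReflection_apply {v : V} (h : B v v ≠ 0) (x : V) :
    orthReflection B v x = x - (2 / B v v * B v x) • v := by
  simp [orthReflection, h, Module.reflection_apply]

theorem orthReflection_apply_self {v : V} (h : B v v ≠ 0) : orthReflection B v v = -v := by
  rw [orthReflection_apply h, div_mul_cancel₀ _ h, two_smul]; abel

theorem orthReflection_apply_of_ortho {v x : V} (h : B v v ≠ 0) (hx : B v x = 0) :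
    orthReflection B v x = x := by
  rw [orthReflection_apply h, hx]; simp

theorem orthReflection_mul_self {v : V} (h : B v v ≠ 0) :
    orthReflection B v * orthReflection B v = 1 := by
  ext x
  rw [LinearEquiv.mul_apply, orthReflection_apply h x, map_sub, map_smul,
    orthReflection_apply_self h, orthReflection_apply h x]
  simp

theorem orthReflection_inv {v : V} (h : B v v ≠ 0) :
    (orthReflection B v)⁻¹ = orthReflection B v :=
  inv_eq_of_mul_eq_one_left (orthReflection_mul_self h)

theorem det_orthReflection [FiniteDimensional ℂ V] {v : V} (h : B v v ≠ 0) :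
    LinearEquiv.det (orthReflection B v) = -1 := by
  -- A map `x ↦ x + f(x) v` has determinant `1 + f(v)`, here `1 - 2`.
  have h1 : (orthReflection B v : V →ₗ[ℂ] V) =
      LinearMap.transvection (-((2 / B v v) • B v)) v := by
    ext x
    simp [orthReflection_apply h, LinearMap.transvection.apply, sub_eq_add_neg]
  rw [← Units.val_inj, LinearEquiv.coe_det, h1, LinearMap.transvection.det]
  simp [h]
  norm_num

theorem orthReflection_smul {v : V} (h : B v v ≠ 0) {c : ℂ} (hc : c ≠ 0) :
    orthReflection B (c • v) = orthReflection B v := by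
  have h' : B (c • v) (c • v) ≠ 0 := by simp [h, hc]
  ext x
  rw [orthReflection_apply h, orthReflection_apply h', smul_smul]
  congr 2
  simp
  field_simp

theorem orthReflection_mem (hB : B.IsSymm) {v : V} (h : B v v ≠ 0) :
    orthReflection B v ∈ isometryGroup B := by
  intro x y
  have := hB.eq x v
  simp only [orthReflection_apply h, map_sub, map_smul, LinearMap.sub_apply, LinearMap.smul_apply,
    smul_eq_mul, ← this]
  field_simp
  ring

theorem conj_orthReflection {g : V ≃ₗ[ℂ] V} (hg : g ∈ isometryGroup B) {v : V} (h : B v v ≠ 0) :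
    g * orthReflection B v * g⁻¹ = orthReflection B (g v) := by
  rw [mul_inv_eq_iff_eq_mul]
  ext x
  have h' : B (g v) (g v) ≠ 0 := by rwa [hg v v]
  rw [LinearEquiv.mul_apply, LinearEquiv.mul_apply, orthReflection_apply h, orthReflection_apply h',
    hg, hg, map_sub, map_smul]

/-- The group generated by orthogonal reflections. -/
noncomputable def reflectionGroup (B : LinearMap.BilinForm ℂ V) : Subgroup (V ≃ₗ[ℂ] V) :=
  Subgroup.closure {s | ∃ v, B v v ≠ 0 ∧ s = orthReflection B v}

theorem orthReflection_mem_reflectionGroup {v : V} (h : B v v ≠ 0) :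
    orthReflection B v ∈ reflectionGroup B :=
  Subgroup.subset_closure ⟨v, h, rfl⟩

theorem reflectionGroup_le (hB : B.IsSymm) : reflectionGroup B ≤ isometryGroup B := by
  rw [reflectionGroup, Subgroup.closure_le]
  rintro _ ⟨v, h, rfl⟩
  exact orthReflection_mem hB h

theorem det_of_mem_reflectionGroup [FiniteDimensional ℂ V] {g : V ≃ₗ[ℂ] V}
    (hg : g ∈ reflectionGroup B) : LinearEquiv.det g = 1 ∨ LinearEquiv.det g = -1 := by
  induction hg using Subgroup.closure_induction with
  | mem x hx => obtain ⟨v, h, rfl⟩ := hx; exact Or.inr (det_orthReflection h)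
  | one => simp
  | mul x y _ _ hx hy => rw [map_mul]; rcases hx with h | h <;> rcases hy with h' | h' <;> simp [h, h']
  | inv x _ hx => rw [map_inv]; rcases hx with h | h <;> simp [h]

/-- Two anisotropic vectors of equal norm are conjugate under the reflection group, by an element
that fixes all vectors orthogonal to both. -/
theorem exists_mem_reflectionGroup_apply_eq (hB : B.IsSymm) {v w : V} (hv : B v v ≠ 0)
    (hvw : B v v = B w w) :
    ∃ r ∈ reflectionGroup B, r w = v ∧ ∀ x, B v x = 0 → B w x = 0 → r x = x := by
  have hs : B w v = B v w := hB.eq w v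
  -- The norms of `v - w` and `v + w` add up to `4 B(v, v) ≠ 0`, so one of them is nonzero. The
  -- reflection in `v - w` swaps `v` and `w`; the one in `v + w` sends `w` to `-v`, which the
  -- reflection in `v` corrects. All mirrors used are normal to vectors of the span of `v` and `w`.
  by_cases h : B (v - w) (v - w) = 0
  · have h2 : B (v + w) (v + w) ≠ 0 := by
      simp only [map_sub, map_add, LinearMap.sub_apply, LinearMap.add_apply] at h ⊢
      intro h'
      exact hv (by linear_combination (h + h') / 4 + hvw / 2)
    refine ⟨_, mul_mem (orthReflection_mem_reflectionGroup hv)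
      (orthReflection_mem_reflectionGroup h2), ?_, fun x hx hx' => ?_⟩
    · have h3 : 2 / B (v + w) (v + w) * B (v + w) w = 1 := by
        rw [div_mul_eq_mul_div, div_eq_one_iff_eq h2]
        simp only [map_add, LinearMap.add_apply, ← hvw, hs]
        ring
      rw [LinearEquiv.mul_apply, orthReflection_apply h2, h3, one_smul, sub_add_cancel_right,
        map_neg, orthReflection_apply_self hv, neg_neg]
    · rw [LinearEquiv.mul_apply, orthReflection_apply_of_ortho h2 (by simp [hx, hx']),
        orthReflection_apply_of_ortho hv hx]
  · refine ⟨_, orthReflection_mem_reflectionGroup h, ?_, fun x hx hx' => ?_⟩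
    · have h3 : 2 / B (v - w) (v - w) * B (v - w) w = -1 := by
        rw [div_mul_eq_mul_div, div_eq_iff h]
        simp only [map_sub, LinearMap.sub_apply, ← hvw, hs]
        ring
      rw [orthReflection_apply h, h3]
      simp
    · exact orthReflection_apply_of_ortho h (by simp [hx, hx'])

/-- A weak form of the Cartan–Dieudonné theorem. -/
theorem mem_reflectionGroup [FiniteDimensional ℂ V] (hB : B.IsSymm) (hB' : B.Nondegenerate)
    {g : V ≃ₗ[ℂ] V} (hg : g ∈ isometryGroup B) : g ∈ reflectionGroup B := by
  classical
  have : Invertible (2 : ℂ) := invertibleOfNonzero two_ne_zero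
  obtain ⟨b, hb⟩ := LinearMap.BilinForm.exists_orthogonal_basis ⟨fun x y => hB.eq x y⟩
  have hb0 : ∀ i, B (b i) (b i) ≠ 0 := fun i =>
    iIsOrtho.not_isOrtho_basis_self_of_nondegenerate hb hB' i
  have hb1 : ∀ i j, i ≠ j → B (b i) (b j) = 0 := fun i j h => hb h
  -- Induction on a set `s` containing all indices of the basis vectors that `g` may move. Bringing
  -- `g (b k)` back to `b k` does not disturb the vectors already fixed, as these are orthogonal to
  -- both.
  have key : ∀ (s : Finset (Fin (finrank ℂ V))) (g : V ≃ₗ[ℂ] V), g ∈ isometryGroup B →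
      (∀ i ∉ s, g (b i) = b i) → g ∈ reflectionGroup B := by
    intro s
    induction s using Finset.induction_on with
    | empty =>
      intro g _ h
      have : g = 1 := LinearEquiv.toLinearMap_injective (b.ext fun i => h i (by simp))
      rw [this]; exact one_mem _
    | insert k s hk ih =>
      intro g hg h
      obtain ⟨r, hr, hr1, hr2⟩ := exists_mem_reflectionGroup_apply_eq hB (w := g (b k)) (hb0 k)
        (hg _ _).symm
      have h1 : r * g ∈ reflectionGroup B := by
        refine ih _ (mul_mem (reflectionGroup_le hB hr) hg) fun i hi => ?_
        rw [LinearEquiv.mul_apply]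
        by_cases hik : i = k
        · rw [hik, hr1]
        · have h2 : g (b i) = b i := h i (by simp [hi, hik])
          rw [h2]
          refine hr2 _ (hb1 _ _ (Ne.symm hik)) ?_
          rw [← h2, hg]
          exact hb1 _ _ (Ne.symm hik)
      exact (Subgroup.mul_mem_cancel_left _ hr).mp h1
  exact key Finset.univ g hg (by simp)

/-- In dimension at least five, two vectors have a common anisotropic orthogonal vector. -/
theorem exists_ortho_pair [FiniteDimensional ℂ V] (hB : B.IsSymm) (hB' : B.Nondegenerate)
    (hV : 5 ≤ finrank ℂ V) (u v : V) {q : ℂ} (hq : q ≠ 0) :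
    ∃ w, B w w = q ∧ B u w = 0 ∧ B v w = 0 := by
  classical
  have hsymm : ∀ x y, B x y = B y x := fun x y => hB.eq x y
  set P := Submodule.span ℂ (({u, v} : Finset V) : Set V) with hP
  have hPc : finrank ℂ P ≤ 2 :=
    (finrank_span_finset_le_card _).trans (Finset.card_le_two)
  have huP : u ∈ P := Submodule.subset_span (by simp)
  have hvP : v ∈ P := Submodule.subset_span (by simp)
  -- Otherwise, by polarization, the orthogonal of `P` is totally isotropic, so it lies in its own
  -- orthogonal, which is `P`; then `dim V - 2 ≤ 2`.
  obtain ⟨x, hx, hx0⟩ : ∃ x ∈ B.orthogonal P, B x x ≠ 0 := by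
    by_contra! hcon
    have h1 : B.orthogonal P ≤ B.orthogonal (B.orthogonal P) := by
      intro x hx y hy
      have h := hcon _ (add_mem hx hy)
      simp only [map_add, LinearMap.add_apply, hcon x hx, hcon y hy, hsymm x y] at h
      change B y x = 0
      linear_combination h / 2
    rw [orthogonal_orthogonal hB' hB.isRefl] at h1
    have h2 := Submodule.finrank_mono h1
    rw [finrank_orthogonal hB'] at h2
    omega
  obtain ⟨c, hc⟩ := IsAlgClosed.exists_pow_nat_eq (q / B x x) (n := 2) (by norm_num)
  refine ⟨c • x, ?_, ?_, ?_⟩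
  · simp only [map_smul, LinearMap.smul_apply, smul_eq_mul, ← mul_assoc, ← sq, hc]
    field_simp
  · simp [show B u x = 0 from hx u huP]
  · simp [show B v x = 0 from hx v hvP]

/-- A normal subgroup of the special orthogonal group of a space of dimension at least five is
everything if it contains a half-turn. -/
theorem specialIsometryGroup_le_of_halfTurn_mem [FiniteDimensional ℂ V] (hB : B.IsSymm)
    (hB' : B.Nondegenerate) (hV : 5 ≤ finrank ℂ V) {K : Subgroup (V ≃ₗ[ℂ] V)}
    (hK : K ≤ specialIsometryGroup B)
    (hconj : ∀ g ∈ specialIsometryGroup B, ∀ k ∈ K, g * k * g⁻¹ ∈ K)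
    {a b : V} (hab : B a b = 0) (ha : B a a ≠ 0) (hb : B b b = B a a)
    (hmem : orthReflection B a * orthReflection B b ∈ K) :
    specialIsometryGroup B ≤ K := by
  have hsymm : ∀ x y, B x y = B y x := fun x y => hB.eq x y
  have hb0 : B b b ≠ 0 := by rwa [hb]
  obtain ⟨c, hc, hac, hbc⟩ := exists_ortho_pair hB hB' hV a b ha
  have hc0 : B c c ≠ 0 := by rwa [hc]
  -- Conjugation carries the pair `(a, b)` to any orthogonal pair of vectors of the same norm.
  have h_orth : ∀ u w, B u u = B a a → B w w = B a a → B u w = 0 →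
      orthReflection B u * orthReflection B w ∈ K := by
    intro u w hu hw huw
    obtain ⟨r, hr, hra, -⟩ := exists_mem_reflectionGroup_apply_eq hB (v := u) (w := a)
      (by rwa [hu]) hu
    have hri := reflectionGroup_le hB hr
    obtain ⟨s, hs, hsb, hsx⟩ := exists_mem_reflectionGroup_apply_eq hB (v := w) (w := r b)
      (by rwa [hw]) (by rw [hri, hw, hb])
    have hsu : s u = u := hsx u (by rw [hsymm, huw]) (by rw [← hra, hri, hsymm, hab])
    have hsi := reflectionGroup_le hB hs
    obtain ⟨g, hg, hga, hgb⟩ : ∃ g ∈ specialIsometryGroup B, g a = u ∧ g b = w := by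
      rcases det_of_mem_reflectionGroup (mul_mem hs hr) with hd | hd
      · exact ⟨s * r, ⟨mul_mem hsi hri, hd⟩, by simp [LinearEquiv.mul_apply, hra, hsu],
          by simp [LinearEquiv.mul_apply, hsb]⟩
      -- The reflection in `c` fixes `a` and `b`, so it repairs the determinant without changing
      -- their images.
      · refine ⟨s * r * orthReflection B c, ⟨mul_mem (mul_mem hsi hri) (orthReflection_mem hB hc0),
          ?_⟩, ?_, ?_⟩
        · change LinearEquiv.det _ = 1
          rw [map_mul, hd, det_orthReflection hc0]; simp
        · rw [LinearEquiv.mul_apply, orthReflection_apply_of_ortho hc0 (by rw [hsymm, hac]),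
            LinearEquiv.mul_apply, hra, hsu]
        · rw [LinearEquiv.mul_apply, orthReflection_apply_of_ortho hc0 (by rw [hsymm, hbc]),
            LinearEquiv.mul_apply, hsb]
    have h := hconj g hg _ hmem
    rwa [← conj_mul, conj_orthReflection hg.1 ha, conj_orthReflection hg.1 hb0, hga, hgb] at h
  -- Orthogonality is removed by inserting the square of the reflection in a vector `z` orthogonal
  -- to both.
  have h_norm : ∀ u w, B u u = B a a → B w w = B a a →
      orthReflection B u * orthReflection B w ∈ K := by
    intro u w hu hw
    obtain ⟨z, hz, huz, hwz⟩ := exists_ortho_pair hB hB' hV u w ha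
    have h := mul_mem (h_orth u z hu hz huz) (h_orth z w hz hw (by rw [hsymm, hwz]))
    rwa [mul_assoc, ← mul_assoc (orthReflection B z), orthReflection_mul_self (by rwa [hz]),
      one_mul] at h
  have h_all : ∀ w, B w w ≠ 0 → orthReflection B a * orthReflection B w ∈ K := by
    intro w hw
    obtain ⟨c, hc⟩ := IsAlgClosed.exists_pow_nat_eq (B a a / B w w) (n := 2) (by norm_num)
    have hc0 : c ≠ 0 := by
      rintro rfl
      exact div_ne_zero ha hw (by rw [← hc]; simp)
    rw [← orthReflection_smul hw hc0]
    refine h_norm _ _ rfl ?_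
    simp only [map_smul, LinearMap.smul_apply, smul_eq_mul, ← mul_assoc, ← sq, hc]
    field_simp
  -- With `R` the reflection in `a`, the union of `K` and `R K` is stable under left multiplication
  -- by reflections, so it contains the whole reflection group. The determinant then tells the two
  -- cosets apart.
  have h_or : ∀ g ∈ reflectionGroup B, g ∈ K ∨ orthReflection B a * g ∈ K := by
    intro g hg
    have hstep : ∀ v, B v v ≠ 0 → ∀ y, y ∈ K ∨ orthReflection B a * y ∈ K →
        orthReflection B v * y ∈ K ∨ orthReflection B a * (orthReflection B v * y) ∈ K := by
      rintro v hv y (hy | hy)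
      · exact Or.inr (by rw [← mul_assoc]; exact mul_mem (h_all v hv) hy)
      · have h := mul_mem (inv_mem (h_all v hv)) hy
        rw [mul_inv_rev, orthReflection_inv hv, orthReflection_inv ha, mul_assoc,
          ← mul_assoc (orthReflection B a), orthReflection_mul_self ha, one_mul] at h
        exact Or.inl h
    induction hg using Subgroup.closure_induction_left with
    | one => exact Or.inl (one_mem _)
    | mul_left x hx y _ hy => obtain ⟨v, hv, rfl⟩ := hx; exact hstep v hv y hy
    | inv_mul_cancel x hx y _ hy =>
      obtain ⟨v, hv, rfl⟩ := hx
      rw [orthReflection_inv hv]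
      exact hstep v hv y hy
  intro g hg
  rcases h_or g (mem_reflectionGroup hB hB' hg.1) with h | h
  · exact h
  · have h1 : LinearEquiv.det (orthReflection B a * g) = 1 := (hK h).2
    rw [map_mul, det_orthReflection ha,
      show LinearEquiv.det g = 1 from hg.2] at h1
    exact absurd (congrArg Units.val h1) (by norm_num)

end Symmetric

end LinearMap.BilinForm

namespace LinearMap.BilinForm

open Module

variable {V : Type*} [AddCommGroup V] [Module ℂ V]

/-! ### Symplectic groups: generation by transvections, normal subgroups containing a partial sign
change. -/

section Alternating

variable {B : LinearMap.BilinForm ℂ V}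

/-- The symplectic transvection `x ↦ x + c B(v, x) v`. -/
noncomputable def sympTransvection (hB : B.IsAlt) (v : V) (c : ℂ) : V ≃ₗ[ℂ] V :=
  LinearEquiv.transvection (f := c • B v) (v := v) (by simp [hB.self_eq_zero v])

theorem sympTransvection_apply (hB : B.IsAlt) (v : V) (c : ℂ) (x : V) :
    sympTransvection hB v c x = x + (c * B v x) • v := rfl

theorem alt_swap (hB : B.IsAlt) (x y : V) : B x y = -B y x := (hB.neg_eq y x).symm

theorem sympTransvection_mem (hB : B.IsAlt) (v : V) (c : ℂ) :
    sympTransvection hB v c ∈ specialIsometryGroup B := by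
  refine ⟨fun x y => ?_, LinearEquiv.transvection.det_eq_one _⟩
  simp only [sympTransvection_apply, map_add, map_smul, LinearMap.add_apply, LinearMap.smul_apply,
    smul_eq_mul, hB.self_eq_zero v, alt_swap hB x v]
  ring

theorem sympTransvection_mul (hB : B.IsAlt) (v : V) (c d : ℂ) :
    sympTransvection hB v c * sympTransvection hB v d = sympTransvection hB v (c + d) := by
  ext x
  simp only [LinearEquiv.mul_apply, sympTransvection_apply, map_add, map_smul,
    hB.self_eq_zero v]
  module

theorem sympTransvection_inv (hB : B.IsAlt) (v : V) (c : ℂ) :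
    (sympTransvection hB v c)⁻¹ = sympTransvection hB v (-c) := by
  refine inv_eq_of_mul_eq_one_left ?_
  rw [sympTransvection_mul]
  ext x
  simp [sympTransvection_apply]

theorem sympTransvection_smul (hB : B.IsAlt) (v : V) (a c : ℂ) :
    sympTransvection hB (a • v) c = sympTransvection hB v (a ^ 2 * c) := by
  ext x
  simp only [sympTransvection_apply, map_smul, LinearMap.smul_apply, smul_eq_mul, smul_smul]
  congr 2
  ring

theorem conj_sympTransvection (hB : B.IsAlt) {g : V ≃ₗ[ℂ] V} (hg : g ∈ isometryGroup B) (v : V)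
    (c : ℂ) : g * sympTransvection hB v c * g⁻¹ = sympTransvection hB (g v) c := by
  rw [mul_inv_eq_iff_eq_mul]
  ext x
  simp only [LinearEquiv.mul_apply, sympTransvection_apply, map_add, map_smul, hg v x]

/-- The group generated by symplectic transvections. -/
noncomputable def transvectionGroup (hB : B.IsAlt) : Subgroup (V ≃ₗ[ℂ] V) :=
  Subgroup.closure (Set.range fun p : V × ℂ => sympTransvection hB p.1 p.2)

theorem sympTransvection_mem_transvectionGroup (hB : B.IsAlt) (v : V) (c : ℂ) :
    sympTransvection hB v c ∈ transvectionGroup hB :=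
  Subgroup.subset_closure ⟨(v, c), rfl⟩

theorem transvectionGroup_le (hB : B.IsAlt) : transvectionGroup hB ≤ specialIsometryGroup B := by
  rw [transvectionGroup, Subgroup.closure_le]
  rintro _ ⟨p, rfl⟩
  exact sympTransvection_mem hB _ _

/-- Two non-orthogonal vectors are conjugate under a transvection. -/
theorem exists_transvection_apply_eq (hB : B.IsAlt) {v w : V} (h : B v w ≠ 0) :
    ∃ r ∈ transvectionGroup hB, r w = v ∧ ∀ x, B (v - w) x = 0 → r x = x := by
  refine ⟨_, sympTransvection_mem_transvectionGroup hB (v - w) (B v w)⁻¹, ?_, fun x hx => ?_⟩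
  · rw [sympTransvection_apply, map_sub, LinearMap.sub_apply, hB.self_eq_zero w, sub_zero,
      inv_mul_cancel₀ h, one_smul, add_sub_cancel]
  · rw [sympTransvection_apply, hx]; simp

/-- The group generated by transvections is transitive on hyperbolic pairs, and the elements that
are needed fix all vectors orthogonal to both pairs. -/
theorem exists_transvectionGroup_pair (hB : B.IsAlt) {e f e' f' : V} (h : B e f = 1)
    (h' : B e' f' = 1) : ∃ r ∈ transvectionGroup hB, r e = e' ∧ r f = f' ∧
      ∀ x, B e x = 0 → B f x = 0 → B e' x = 0 → B f' x = 0 → r x = x := by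
  have via : ∀ z, B e z ≠ 0 → B z e' ≠ 0 → ∃ r ∈ transvectionGroup hB, r e = e' ∧
      ∀ x, B e x = 0 → B z x = 0 → B e' x = 0 → r x = x := by
    intro z hz hz'
    obtain ⟨r, hr, hre, hrx⟩ := exists_transvection_apply_eq hB (v := z) (w := e)
      (by rw [alt_swap hB]; simpa using hz)
    obtain ⟨s, hs, hse, hsx⟩ := exists_transvection_apply_eq hB (v := e') (w := z)
      (by rw [alt_swap hB]; simpa using hz')
    refine ⟨s * r, mul_mem hs hr, by rw [LinearEquiv.mul_apply, hre, hse], fun x h1 h2 h3 => ?_⟩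
    rw [LinearEquiv.mul_apply, hrx x (by simp [h1, h2]), hsx x (by simp [h2, h3])]
  obtain ⟨r, hr, hre, hrx⟩ : ∃ r ∈ transvectionGroup hB, r e = e' ∧
      ∀ x, B e x = 0 → B f x = 0 → B e' x = 0 → B f' x = 0 → r x = x := by
    -- The intermediate vector must be orthogonal to neither `e` nor `e'`: one of `f`, `f'`, `f +
    -- f'` qualifies.
    by_cases h1 : B f e' = 0
    · by_cases h2 : B e f' = 0
      · obtain ⟨r, hr, hre, hrx⟩ := via (f + f') (by simp [h, h2])
          (by simp [h1, alt_swap hB f' e', h'])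
        exact ⟨r, hr, hre, fun x p1 p2 p3 p4 => hrx x p1 (by simp [p2, p4]) p3⟩
      · obtain ⟨r, hr, hre, hrx⟩ := via f' h2 (by simp [alt_swap hB f' e', h'])
        exact ⟨r, hr, hre, fun x p1 p2 p3 p4 => hrx x p1 p4 p3⟩
    · obtain ⟨r, hr, hre, hrx⟩ := via f (by simp [h]) h1
      exact ⟨r, hr, hre, fun x p1 p2 p3 p4 => hrx x p1 p2 p3⟩
  have hri := (transvectionGroup_le hB hr).1
  have hef : B e' (r f) = 1 := by rw [← hre, hri, h]
  have hfe : B (r f) e' = -1 := by rw [alt_swap hB, hef]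
  have hfe' : B f' e' = -1 := by rw [alt_swap hB, h']
  obtain ⟨s, hs, hse, hsf, hsx⟩ : ∃ s ∈ transvectionGroup hB, s e' = e' ∧ s (r f) = f' ∧
      ∀ x, B (r f) x = 0 → B e' x = 0 → B f' x = 0 → s x = x := by
    -- The direction `f' - r f` is orthogonal to `e'`, so its transvection fixes `e'`. If `f'` and
    -- `r f` are orthogonal, the detour through `r f + e'` keeps both directions orthogonal to `e'`.
    by_cases h1 : B f' (r f) = 0
    · obtain ⟨s, hs, hsf, hsx⟩ := exists_transvection_apply_eq hB (v := r f + e') (w := r f)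
        (by simp [hef, hB.self_eq_zero])
      obtain ⟨t, ht, htf, htx⟩ := exists_transvection_apply_eq hB (v := f') (w := r f + e')
        (by simp [h1, hfe'])
      refine ⟨t * s, mul_mem ht hs, ?_, by rw [LinearEquiv.mul_apply, hsf, htf],
        fun x p1 p2 p3 => ?_⟩
      · rw [LinearEquiv.mul_apply, hsx e' (by simp [hB.self_eq_zero]),
          htx e' (by simp [hB.self_eq_zero, hfe, hfe'])]
      · rw [LinearEquiv.mul_apply, hsx x (by simp [p2]), htx x (by simp [p1, p2, p3])]
    · obtain ⟨s, hs, hsf, hsx⟩ := exists_transvection_apply_eq hB (v := f') (w := r f) h1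
      exact ⟨s, hs, hsx e' (by simp [hfe, hfe']), hsf, fun x p1 p2 p3 => hsx x (by simp [p1, p3])⟩
  refine ⟨s * r, mul_mem hs hr, by rw [LinearEquiv.mul_apply, hre, hse],
    by rw [LinearEquiv.mul_apply, hsf], fun x p1 p2 p3 p4 => ?_⟩
  have hx := hrx x p1 p2 p3 p4
  rw [LinearEquiv.mul_apply, hx]
  exact hsx x (by rw [← hx, hri, p2]) p3 p4

/-- A symplectic basis, given by its hyperbolic pairs. -/
structure IsSymplecticBasis {ι : Type*} (B : LinearMap.BilinForm ℂ V) (e f : ι → V) : Prop where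
  left : ∀ i j, B (e i) (e j) = 0
  right : ∀ i j, B (f i) (f j) = 0
  pair : ∀ i, B (e i) (f i) = 1
  cross : ∀ i j, i ≠ j → B (e i) (f j) = 0
  span : Submodule.span ℂ (Set.range e ∪ Set.range f) = ⊤

variable {ι : Type*} {e f : ι → V}

/-- The symplectic group is generated by transvections. -/
theorem IsSymplecticBasis.mem_transvectionGroup [Finite ι] (hb : IsSymplecticBasis B e f)
    (hB : B.IsAlt) {g : V ≃ₗ[ℂ] V} (hg : g ∈ isometryGroup B) : g ∈ transvectionGroup hB := by
  classical
  have := Fintype.ofFinite ι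
  -- As for reflections, but one hyperbolic pair is restored at a time.
  have key : ∀ (s : Finset ι) (g : V ≃ₗ[ℂ] V), g ∈ isometryGroup B →
      (∀ i ∉ s, g (e i) = e i ∧ g (f i) = f i) → g ∈ transvectionGroup hB := by
    intro s
    induction s using Finset.induction_on with
    | empty =>
      intro g _ h
      have : g = 1 := by
        refine LinearEquiv.toLinearMap_injective (LinearMap.ext_on hb.span ?_)
        rintro _ (⟨i, rfl⟩ | ⟨i, rfl⟩)
        · exact (h i (by simp)).1
        · exact (h i (by simp)).2
      rw [this]; exact one_mem _
    | insert k s hk ih =>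
      intro g hg h
      obtain ⟨r, hr, hre, hrf, hrx⟩ := exists_transvectionGroup_pair hB (e := g (e k))
        (f := g (f k)) (by rw [hg, hb.pair]) (hb.pair k)
      have h1 : r * g ∈ transvectionGroup hB := by
        refine ih _ (mul_mem (transvectionGroup_le hB hr).1 hg) fun i hi => ?_
        rw [LinearEquiv.mul_apply, LinearEquiv.mul_apply]
        by_cases hik : i = k
        · rw [hik]; exact ⟨hre, hrf⟩
        · obtain ⟨h2, h3⟩ := h i (by simp [hi, hik])
          have c1 := hb.cross k i (Ne.symm hik)
          have c2 : B (f k) (e i) = 0 := by rw [alt_swap hB, hb.cross i k hik, neg_zero]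
          rw [h2, h3]
          constructor
          · refine hrx _ ?_ ?_ (hb.left _ _) c2
            · rw [← h2, hg]; exact hb.left _ _
            · rw [← h2, hg]; exact c2
          · refine hrx _ ?_ ?_ c1 (hb.right _ _)
            · rw [← h3, hg]; exact c1
            · rw [← h3, hg]; exact hb.right _ _
      exact (Subgroup.mul_mem_cancel_left _ hr).mp h1
  exact key Finset.univ g hg (by simp)

/-- A normal subgroup of the symplectic group of a space of dimension at least four is everything
if it contains an element that is `-1` on a hyperbolic plane and `1` on its orthogonal. -/
theorem IsSymplecticBasis.specialIsometryGroup_le [Finite ι] (hb : IsSymplecticBasis B e f)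
    (hB : B.IsAlt) {i j : ι} (hij : i ≠ j) {K : Subgroup (V ≃ₗ[ℂ] V)}
    (hK : K ≤ specialIsometryGroup B)
    (hconj : ∀ g ∈ specialIsometryGroup B, ∀ k ∈ K, g * k * g⁻¹ ∈ K)
    {ε : V ≃ₗ[ℂ] V} (hε : ε ∈ K) (hεe : ε (e i) = -e i)
    (hεx : ∀ x, B (e i) x = 0 → B (f i) x = 0 → ε x = x) :
    specialIsometryGroup B ≤ K := by
  -- A conjugate `k` of `ε` negates `h` and fixes the orthogonal of the plane of `h` and `h'`, which
  -- contains `v - h`. Hence `k v = v - 2h`, and the claimed element is the commutator of `k` with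
  -- the transvection along `v`.
  have flip : ∀ v h h' : V, B h h' = 1 → B h v = 0 → B h' (v - h) = 0 → ∀ c,
      sympTransvection hB (v - (2 : ℂ) • h) c * (sympTransvection hB v c)⁻¹ ∈ K := by
    intro v h h' hh hv hv' c
    obtain ⟨g, hg, hge, hgf, -⟩ := exists_transvectionGroup_pair hB (hb.pair i) hh
    have hg' := transvectionGroup_le hB hg
    have hgε := hconj g hg' ε hε
    set k := g * ε * g⁻¹ with hk
    have hginv : ∀ x, g (g⁻¹ x) = x := fun x => by
      rw [← LinearEquiv.mul_apply, mul_inv_cancel]; rfl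
    have hginv' : ∀ x, g⁻¹ (g x) = x := fun x => by
      rw [← LinearEquiv.mul_apply, inv_mul_cancel]; rfl
    have hkh : k h = -h := by
      rw [← hge, hk, LinearEquiv.mul_apply, LinearEquiv.mul_apply, hginv', hεe, map_neg]
    have hkv : k (v - h) = v - h := by
      rw [hk, LinearEquiv.mul_apply, LinearEquiv.mul_apply, hεx, hginv]
      · rw [← hg'.1, hginv, hge, map_sub, hv, hB.self_eq_zero, sub_zero]
      · rw [← hg'.1, hginv, hgf, hv']
    have hkv' : k v = v - (2 : ℂ) • h := by
      have h1 := congrArg₂ (· + ·) hkv hkh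
      simp only [← map_add, sub_add_cancel] at h1
      rw [h1]; module
    have h1 := mul_mem hgε (hconj _ (sympTransvection_mem hB v c) _ (inv_mem hgε))
    rw [← hkv', ← conj_sympTransvection hB (hK hgε).1]
    simpa only [mul_assoc] using h1
  have fe : ∀ k, B (f k) (e k) = -1 := fun k => by rw [alt_swap hB, hb.pair]
  have fe' : ∀ k l, k ≠ l → B (f k) (e l) = 0 := fun k l hkl => by
    rw [alt_swap hB, hb.cross _ _ hkl.symm, neg_zero]
  -- Two flips lead from `e j` through `e j + e i` to `2 • e j`. Doubling the vector multiplies the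
  -- parameter by `4`, so the telescoping product has parameter `4c - c`. The partners `h'` are
  -- chosen to pair to `1` with `h` and to `0` with `v - h`.
  have h3 : ∀ c, sympTransvection hB (e j) (3 * c) ∈ K := by
    intro c
    have h1 := flip (e j) (-(1 / 2 : ℂ) • e i) ((-2 : ℂ) • f i + f j)
      (by simp [hb.pair, hb.cross _ _ hij]) (by simp [hb.left])
      (by simp [fe, fe' _ _ hij, fe' _ _ hij.symm]) c
    have h2 := flip (e j + e i) ((1 / 2 : ℂ) • (e i - e j)) ((3 / 2 : ℂ) • f i - (1 / 2 : ℂ) • f j)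
      (by simp [hb.pair, hb.cross _ _ hij, hb.cross _ _ hij.symm]; norm_num) (by simp [hb.left])
      (by simp [fe, fe' _ _ hij, fe' _ _ hij.symm]; norm_num) c
    rw [show e j - (2 : ℂ) • (-(1 / 2 : ℂ) • e i) = e j + e i by module] at h1
    rw [show e j + e i - (2 : ℂ) • ((1 / 2 : ℂ) • (e i - e j)) = (2 : ℂ) • e j by module] at h2
    have h := mul_mem h2 h1
    rw [mul_assoc, inv_mul_cancel_left, sympTransvection_smul, sympTransvection_inv,
      sympTransvection_mul] at h
    convert h using 2
    ring
  -- A vector outside the radical belongs to a hyperbolic pair after scaling its partner, so it is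
  -- conjugate to `e j`.
  have h4 : ∀ v c, sympTransvection hB v c ∈ K := by
    intro v c
    by_cases hv : ∀ w, B v w = 0
    · have : sympTransvection hB v c = 1 := by
        ext x; simp [sympTransvection_apply, hv]
      rw [this]; exact one_mem _
    · push Not at hv
      obtain ⟨w, hw⟩ := hv
      obtain ⟨g, hg, hge, -, -⟩ := exists_transvectionGroup_pair hB (hb.pair j)
        (e' := v) (f' := (B v w)⁻¹ • w) (by simp [hw])
      have hg' := transvectionGroup_le hB hg
      have h := hconj g hg' _ (h3 (c / 3))
      rwa [conj_sympTransvection hB hg'.1, hge, mul_div_cancel₀ _ (by norm_num)] at h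
  have h5 : transvectionGroup hB ≤ K := by
    rw [transvectionGroup, Subgroup.closure_le]
    rintro _ ⟨p, rfl⟩
    exact h4 _ _
  exact fun g hg => h5 (hb.mem_transvectionGroup hB hg.1)

end Alternating

end LinearMap.BilinForm

namespace ClassicalGroups

open Matrix LinearMap.BilinForm

variable {X : Family} {n : ℕ}

/-! ### The Springer morphism and characters at involutions of the torus. -/

theorem adj_mat_mul_mat (g : G X n) : adj (mat g) * mat g = 1 := by
  have h : (mat g)ᵀ * form X n * mat g = form X n := g.2
  rw [adj, mul_assoc, mul_assoc, ← mul_assoc (mat g)ᵀ, h, formInv_mul_form]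

/-- The Springer morphism vanishes on the elements of order two of the torus. -/
theorem springerTorus_eq_zero {t : torus X n} (ht : t * t = 1) : springerTorus X n t = 0 := by
  have h1 : mat t.1 * mat t.1 = 1 :=
    congrArg (fun s : torus X n => mat s.1) ht
  have h2 : adj (mat t.1) = mat t.1 := by
    calc adj (mat t.1) = adj (mat t.1) * mat t.1 * mat t.1 := by rw [mul_assoc, h1, mul_one]
      _ = mat t.1 := by rw [adj_mat_mul_mat, one_mul]
  apply Subtype.ext
  change (springer X n t.1 : Matrix (Fin (X.dim n)) (Fin (X.dim n)) ℂ) = 0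
  rw [springer_eq, h2, sub_self, smul_zero]

/-- The endomorphism `(1 - f) / 2` is idempotent of trace zero, and in characteristic zero the trace
of an idempotent is its rank. -/
theorem eq_one_of_trace_eq_finrank {V : Type*} [AddCommGroup V] [Module ℂ V]
    [FiniteDimensional ℂ V] {f : Module.End ℂ V} (hf : f * f = 1)
    (ht : LinearMap.trace ℂ V f = Module.finrank ℂ V) : f = 1 := by
  have hid : IsIdempotentElem ((1 / 2 : ℂ) • (1 - f)) := by
    rw [IsIdempotentElem, smul_mul_smul_comm, sub_mul, mul_sub, mul_sub, hf, one_mul, mul_one,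
      one_mul]
    module
  have h0 := (LinearMap.IsIdempotentElem.trace_eq_zero_iff hid).mp (by simp [ht])
  have h1 : (1 : Module.End ℂ V) - f = 0 := (smul_eq_zero_iff_right (by norm_num)).mp h0
  exact (sub_eq_zero.mp h1).symm

/-- If the character of a representation is in `Rep^ℂ_poly(G)`, then all elements of order two of
the torus act trivially. -/
theorem apply_eq_one_of_mem_RepPoly {V : Type*} [AddCommGroup V] [Module ℂ V]
    [FiniteDimensional ℂ V] {ρ : Representation ℂ (G X n) V}
    (h : torusCharacter ρ ∈ RepPoly X n) {t : torus X n} (ht : t * t = 1) : ρ t.1 = 1 := by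
  obtain ⟨p, -, hp⟩ := h
  have hχ : ∀ s : torus X n, ρ.character s.1 = p (springerTorus X n s) :=
    fun s => (congrFun hp s).symm
  refine eq_one_of_trace_eq_finrank ?_ ?_
  · rw [← map_mul, show t.1 * t.1 = 1 from congrArg Subtype.val ht, map_one]
  · change ρ.character t.1 = _
    rw [hχ, springerTorus_eq_zero ht, ← springerTorus_eq_zero (mul_one (1 : torus X n)), ← hχ]
    exact ρ.char_one

/-! ### The classical groups as special isometry groups, and their sign elements. -/

/-- The invariant bilinear form on `ℂ^N`. -/
noncomputable def bilin (X : Family) (n : ℕ) : LinearMap.BilinForm ℂ (Fin (X.dim n) → ℂ) :=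
  Matrix.toBilin' (form X n)

theorem bilin_apply (x y : Fin (X.dim n) → ℂ) : bilin X n x y = x ⬝ᵥ form X n *ᵥ y :=
  Matrix.toBilin'_apply' _ _ _

theorem form_mulVec_apply (y : Fin (X.dim n) → ℂ) (i : Fin (X.dim n)) :
    (form X n *ᵥ y) i = X.entry n i * y i.rev := by
  simp [mulVec, dotProduct, form]

theorem bilin_single (i : Fin (X.dim n)) (y : Fin (X.dim n) → ℂ) :
    bilin X n (Pi.single i 1) y = X.entry n i * y i.rev := by
  rw [bilin_apply, single_dotProduct, one_mul, form_mulVec_apply]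

theorem bilin_nondegenerate : (bilin X n).Nondegenerate := by
  refine LinearMap.BilinForm.nondegenerate_toBilin'_of_det_ne_zero' _ fun h => ?_
  have := congrArg det (form_mul_formInv X n)
  rw [det_mul, h, zero_mul, det_one] at this
  exact zero_ne_one this

theorem bilin_swap {ε : ℂ} (h : (form X n)ᵀ = ε • form X n) (x y : Fin (X.dim n) → ℂ) :
    bilin X n x y = ε * bilin X n y x := by
  rw [bilin_apply, bilin_apply, dotProduct_mulVec, ← mulVec_transpose, h, smul_mulVec,
    smul_dotProduct, dotProduct_comm, smul_eq_mul]

/-- The group `G` acting on `ℂ^N`. -/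
def toAut (X : Family) (n : ℕ) : G X n →* ((Fin (X.dim n) → ℂ) ≃ₗ[ℂ] (Fin (X.dim n) → ℂ)) :=
  Matrix.SpecialLinearGroup.toLin'.comp (G X n).subtype

theorem toAut_apply (g : G X n) (x : Fin (X.dim n) → ℂ) : toAut X n g x = mat g *ᵥ x := rfl

theorem toAut_injective : Function.Injective (toAut X n) :=
  Matrix.SpecialLinearGroup.toLin'_injective.comp Subtype.val_injective

/-- This transfers the question about normal subgroups of the matrix group to the coordinate-free
results. -/
theorem range_toAut : (toAut X n).range = specialIsometryGroup (bilin X n) := by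
  ext g
  constructor
  · rintro ⟨g, rfl⟩
    refine ⟨fun x y => ?_, ?_⟩
    · have h : (mat g)ᵀ * form X n * mat g = form X n := g.2
      rw [toAut_apply, toAut_apply, bilin_apply, bilin_apply, ← vecMul_transpose,
        ← dotProduct_mulVec, mulVec_mulVec, mulVec_mulVec, h]
    · change LinearEquiv.det (toAut X n g) = 1
      rw [← Units.val_inj, LinearEquiv.coe_det]
      change LinearMap.det (Matrix.toLin' (mat g)) = 1
      rw [LinearMap.det_toLin']
      exact g.1.2
  · rintro ⟨hg, hd⟩
    have hd' : LinearMap.det (g : (Fin (X.dim n) → ℂ) →ₗ[ℂ] (Fin (X.dim n) → ℂ)) = 1 := by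
      rw [← LinearEquiv.coe_det, show LinearEquiv.det g = 1 from hd, Units.val_one]
    set M := LinearMap.toMatrix' (g : (Fin (X.dim n) → ℂ) →ₗ[ℂ] (Fin (X.dim n) → ℂ)) with hM
    have hMx : ∀ x, M *ᵥ x = g x := fun x => LinearMap.toMatrix'_mulVec _ x
    have h1 : Mᵀ * form X n * M = form X n := by
      apply Matrix.toBilin'.injective
      refine LinearMap.ext₂ fun x y => ?_
      have h := hg x y
      rw [bilin_apply, bilin_apply, ← hMx, ← hMx, ← vecMul_transpose, ← dotProduct_mulVec,
        mulVec_mulVec, mulVec_mulVec] at h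
      rwa [Matrix.toBilin'_apply', Matrix.toBilin'_apply']
    refine ⟨⟨⟨M, by rw [hM, LinearMap.det_toMatrix', hd']⟩, h1⟩, ?_⟩
    exact LinearEquiv.ext fun x => hMx x

/-- The diagonal entries of the element of the torus with `tₖ = -1` and all other coordinates
equal to `1`. -/
def signs (k : Fin (X.dim n)) (i : Fin (X.dim n)) : ℂ :=
  if i ∈ ({k, k.rev} : Finset (Fin (X.dim n))) then -1 else 1

theorem signs_mul_self (k i : Fin (X.dim n)) : signs k i * signs k i = 1 := by
  rw [signs]; split_ifs <;> norm_num

theorem signs_rev (k i : Fin (X.dim n)) : signs k i.rev = signs k i := by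
  simp only [signs, Finset.mem_insert, Finset.mem_singleton, Fin.rev_eq_iff, Fin.rev_rev,
    or_comm (a := i = k.rev)]

/-- The element of the torus with `tₖ = -1` and all other coordinates equal to `1`. -/
def signElement {k : Fin (X.dim n)} (hk : k ≠ k.rev) : torus X n :=
  ⟨⟨⟨diagonal (signs k), by
      rw [det_diagonal]
      simp only [signs, Finset.prod_ite_mem, Finset.univ_inter]
      rw [Finset.prod_pair hk]; norm_num⟩, by
      change (diagonal (signs k))ᵀ * form X n * diagonal (signs k) = form X n
      ext i j
      rw [diagonal_transpose, mul_diagonal, diagonal_mul, form]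
      split_ifs with h
      · rw [h, signs_rev, mul_right_comm, signs_mul_self, one_mul]
      · simp⟩, isDiag_diagonal _⟩

theorem signElement_mul_self {k : Fin (X.dim n)} (hk : k ≠ k.rev) :
    signElement hk * signElement hk = 1 := by
  apply Subtype.ext; apply Subtype.ext; apply Subtype.ext
  change diagonal (signs k) * diagonal (signs k) = 1
  simp [diagonal_mul_diagonal, signs_mul_self]

theorem toAut_signElement {k : Fin (X.dim n)} (hk : k ≠ k.rev) (x : Fin (X.dim n) → ℂ)
    (i : Fin (X.dim n)) : toAut X n (signElement hk).1 x i = signs k i * x i := by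
  rw [toAut_apply]
  exact mulVec_diagonal _ _ _

/-- The product of the reflections in `eₖ + e₋ₖ` and `i (eₖ - e₋ₖ)`. -/
theorem toAut_signElement_eq {k : Fin (X.dim n)} (hk : k ≠ k.rev)
    (h1 : X.entry n k = 1) (h1' : X.entry n k.rev = 1) :
    ∃ a b : Fin (X.dim n) → ℂ, bilin X n a b = 0 ∧ bilin X n a a ≠ 0 ∧
      bilin X n b b = bilin X n a a ∧
      toAut X n (signElement hk).1 = orthReflection (bilin X n) a * orthReflection (bilin X n) b := by
  set u : Fin (X.dim n) → ℂ := Pi.single k 1 with hu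
  set v : Fin (X.dim n) → ℂ := Pi.single k.rev 1 with hv
  have hux : ∀ x, bilin X n u x = x k.rev := fun x => by rw [hu, bilin_single, h1, one_mul]
  have hvx : ∀ x, bilin X n v x = x k := fun x => by
    rw [hv, bilin_single, h1', one_mul, Fin.rev_rev]
  have uk : u k = 1 := by simp [hu]
  have ukr : u k.rev = 0 := by simp [hu, hk.symm]
  have vk : v k = 0 := by simp [hv, hk]
  have vkr : v k.rev = 1 := by simp [hv]
  have haa : bilin X n (u + v) (u + v) = 2 := by
    simp [hux, hvx, uk, ukr, vk, vkr]; norm_num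
  -- The norm of `u - v` is `-2`; the factor `i` makes it equal to that of `u + v`, as the half-turn
  -- criterion demands.
  have hbb : bilin X n (Complex.I • (u - v)) (Complex.I • (u - v)) = 2 := by
    simp only [map_sub, map_smul, LinearMap.sub_apply, LinearMap.smul_apply, hux, hvx, uk, ukr, vk,
      vkr, smul_eq_mul]
    linear_combination -2 * Complex.I_mul_I
  refine ⟨u + v, Complex.I • (u - v), ?_, by rw [haa]; norm_num, by rw [haa, hbb], ?_⟩
  · simp [hux, hvx, uk, ukr, vk, vkr]
  · refine LinearEquiv.ext fun x => ?_
    have haa' : bilin X n (u + v) (u + v) ≠ 0 := by rw [haa]; norm_num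
    have hbb' : bilin X n (Complex.I • (u - v)) (Complex.I • (u - v)) ≠ 0 := by
      rw [hbb]; norm_num
    rw [LinearEquiv.mul_apply, orthReflection_apply haa', orthReflection_apply hbb', haa, hbb]
    funext i
    rw [toAut_signElement]
    simp only [map_sub, map_smul, map_add, LinearMap.sub_apply, LinearMap.add_apply,
      LinearMap.smul_apply, hux, hvx, uk, ukr, vk, vkr, smul_eq_mul, Pi.sub_apply, Pi.add_apply,
      Pi.smul_apply, signs, Finset.mem_insert, Finset.mem_singleton]
    have hI := Complex.I_mul_I
    by_cases hik : i = k
    · subst hik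
      simp only [uk, vk, true_or, if_true]
      linear_combination (x i.rev - x i) * hI
    · by_cases hikr : i = k.rev
      · subst hikr
        simp only [ukr, vkr, or_true, if_true]
        linear_combination (x k - x k.rev) * hI
      · have ui : u i = 0 := by simp [hu, hik]
        have vi : v i = 0 := by simp [hv, hikr]
        simp [hik, hikr, ui, vi]

/-! ### Normal subgroups of the classical groups that contain sign elements. -/

section Normal

variable {K : Subgroup (G X n)}

theorem map_le_specialIsometryGroup : K.map (toAut X n) ≤ specialIsometryGroup (bilin X n) := by
  rw [← range_toAut]; exact Subgroup.map_le_range _ _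

theorem conj_mem_map [hK : K.Normal] :
    ∀ g ∈ specialIsometryGroup (bilin X n), ∀ k ∈ K.map (toAut X n),
      g * k * g⁻¹ ∈ K.map (toAut X n) := by
  rw [← range_toAut]
  rintro _ ⟨g, rfl⟩ _ ⟨k, hk, rfl⟩
  exact ⟨g * k * g⁻¹, hK.conj_mem k hk g, by simp⟩

theorem eq_top_of_specialIsometryGroup_le
    (h : specialIsometryGroup (bilin X n) ≤ K.map (toAut X n)) : K = ⊤ := by
  rw [← range_toAut, MonoidHom.range_eq_map,
    Subgroup.map_le_map_iff_of_injective toAut_injective] at h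
  exact top_le_iff.mp h

theorem bilin_isSymm (h : (form X n)ᵀ = form X n) : (bilin X n).IsSymm :=
  ⟨fun x y => by rw [bilin_swap (ε := 1) (by rw [h, one_smul]) x y, one_mul]⟩

/-- The sign element is a half-turn in the plane of the coordinates `k` and `k.rev`. The entry
conditions normalize the form on this plane. -/
theorem eq_top_of_orthogonal [K.Normal] (hs : (form X n)ᵀ = form X n) (hN : 5 ≤ X.dim n)
    {k : Fin (X.dim n)} (hk : k ≠ k.rev) (h1 : X.entry n k = 1) (h1' : X.entry n k.rev = 1)
    (hmem : (signElement hk).1 ∈ K) : K = ⊤ := by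
  have hs' := bilin_isSymm hs
  obtain ⟨a, b, hab, ha, hb, h⟩ := toAut_signElement_eq hk h1 h1'
  refine eq_top_of_specialIsometryGroup_le (specialIsometryGroup_le_of_halfTurn_mem hs'
    bilin_nondegenerate (by simpa using hN) map_le_specialIsometryGroup conj_mem_map hab ha hb ?_)
  rw [← h]
  exact Subgroup.mem_map_of_mem _ hmem

theorem form_transpose_eq_smul {ε : ℂ} (h : ∀ i, X.entry n (Fin.rev i) = ε * X.entry n i) :
    (form X n)ᵀ = ε • form X n := by
  ext i j
  change (if i = j.rev then X.entry n j else 0) = ε * (if j = i.rev then X.entry n i else 0)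
  by_cases hij : j = i.rev
  · subst hij; simp [h]
  · have : i ≠ j.rev := fun h' => hij (by rw [h', Fin.rev_rev])
    simp [hij, this]

/-- The index of the coordinate `tᵢ`. -/
def coordIndex (X : Family) {n : ℕ} (i : Fin n) : Fin (X.dim n) :=
  ⟨i, by have := i.isLt; cases X <;> simp only [Family.dim] <;> omega⟩

theorem coordIndex_rev_val (i : Fin n) : (coordIndex X i).rev.val = X.dim n - (i + 1) :=
  Fin.val_rev _

theorem coordIndex_ne_rev (i j : Fin n) : coordIndex X i ≠ (coordIndex X j).rev := by
  intro h
  have h' := congrArg Fin.val h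
  rw [coordIndex_rev_val] at h'
  have h1 : (coordIndex X i).val = i := rfl
  have := i.isLt
  have := j.isLt
  cases X <;> simp only [Family.dim] at h' <;> omega

theorem coordIndex_injective : Function.Injective (coordIndex X (n := n)) :=
  fun i j h => Fin.ext (show (coordIndex X i).val = (coordIndex X j).val by rw [h])

theorem exists_coordIndex (k : Fin (Family.C.dim n)) :
    ∃ i : Fin n, k = coordIndex .C i ∨ k = (coordIndex .C i).rev := by
  have hk : k.val < 2 * n := k.isLt
  by_cases h : k.val < n
  · exact ⟨⟨k, h⟩, Or.inl rfl⟩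
  · refine ⟨⟨2 * n - (k + 1), by omega⟩, Or.inr (Fin.ext ?_)⟩
    rw [coordIndex_rev_val]
    simp only [Family.dim]
    omega

theorem entry_coordIndex_C (i : Fin n) : Family.C.entry n (coordIndex .C i) = -1 :=
  if_pos i.isLt

theorem entry_coordIndex_rev_C (i : Fin n) : Family.C.entry n (coordIndex .C i).rev = 1 := by
  refine if_neg ?_
  rw [coordIndex_rev_val]
  have := i.isLt
  simp only [Family.dim]
  omega

theorem bilin_C_isAlt : (bilin .C n).IsAlt := by
  intro x
  have h := bilin_swap (form_transpose_eq_smul (X := .C) (n := n) (ε := -1) fun i => by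
    have hi : i.val < 2 * n := i.isLt
    have hr : (Fin.rev i).val = 2 * n - (i.val + 1) := Fin.val_rev i
    have : (Fin.rev i).val < n ↔ ¬ i.val < n := by omega
    simp only [Family.entry, this]
    split_ifs <;> simp_all) x x
  linear_combination h / 2

/-- The first vector of each pair sits at the reversed index because the form has entry `+1` in that
row, so that the pairing is `1` and not `-1`. -/
theorem isSymplecticBasis_C : IsSymplecticBasis (bilin .C n)
    (fun i => Pi.single (coordIndex .C i).rev 1) (fun i => Pi.single (coordIndex .C i) 1) where
  left i j := by
    rw [bilin_single, Fin.rev_rev, Pi.single_eq_of_ne (coordIndex_ne_rev i j), mul_zero]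
  right i j := by
    rw [bilin_single, Pi.single_eq_of_ne (coordIndex_ne_rev j i).symm, mul_zero]
  pair i := by
    rw [bilin_single, Fin.rev_rev, Pi.single_eq_same, entry_coordIndex_rev_C, mul_one]
  cross i j hij := by
    rw [bilin_single, Fin.rev_rev, Pi.single_eq_of_ne (coordIndex_injective.ne hij), mul_zero]
  span := by
    rw [eq_top_iff, ← (Pi.basisFun ℂ (Fin (Family.C.dim n))).span_eq]
    refine Submodule.span_mono ?_
    rintro _ ⟨k, rfl⟩
    rw [Pi.basisFun_apply]
    obtain ⟨i, rfl | rfl⟩ := exists_coordIndex k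
    · exact Or.inr ⟨i, rfl⟩
    · exact Or.inl ⟨i, rfl⟩

/-- The sign element is `-1` on the `i`-th hyperbolic plane and `1` on its orthogonal; the index `j`
provides the second plane that the construction of a transvection needs. -/
theorem eq_top_of_symplectic {K : Subgroup (G .C n)} [K.Normal] {i j : Fin n} (hij : i ≠ j)
    (hmem : (signElement (coordIndex_ne_rev (X := .C) i i)).1 ∈ K) : K = ⊤ := by
  refine eq_top_of_specialIsometryGroup_le (isSymplecticBasis_C.specialIsometryGroup_le
    bilin_C_isAlt hij map_le_specialIsometryGroup conj_mem_map (Subgroup.mem_map_of_mem _ hmem)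
    ?_ fun x h h' => ?_)
  · funext k
    rw [toAut_signElement, Pi.neg_apply]
    by_cases hk : k = (coordIndex .C i).rev
    · subst hk; simp [signs]
    · rw [Pi.single_eq_of_ne hk]; simp
  · rw [bilin_single, Fin.rev_rev, entry_coordIndex_rev_C, one_mul] at h
    rw [bilin_single, entry_coordIndex_C, neg_one_mul, neg_eq_zero] at h'
    funext k
    rw [toAut_signElement]
    by_cases hk : k = coordIndex .C i
    · rw [hk, h, mul_zero]
    · by_cases hk' : k = (coordIndex .C i).rev
      · rw [hk', h', mul_zero]
      · simp [signs, hk, hk']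

theorem entry_coordIndex_B (i : Fin n) : Family.B.entry n (coordIndex .B i) = 1 :=
  if_neg i.isLt.ne

theorem entry_coordIndex_rev_B (i : Fin n) : Family.B.entry n (coordIndex .B i).rev = 1 := by
  refine if_neg ?_
  rw [coordIndex_rev_val]
  have := i.isLt
  simp only [Family.dim]
  omega

theorem form_B_transpose : (form .B n)ᵀ = form .B n := by
  have h := form_transpose_eq_smul (X := .B) (n := n) (ε := 1) fun i => by
    have hi : i.val < 2 * n + 1 := i.isLt
    have hr : (Fin.rev i).val = 2 * n + 1 - (i.val + 1) := Fin.val_rev i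
    have : (Fin.rev i).val = n ↔ i.val = n := by omega
    simp only [Family.entry, this, one_mul]
  rwa [one_smul] at h

theorem form_D_transpose : (form .D n)ᵀ = form .D n := by
  have h := form_transpose_eq_smul (X := .D) (n := n) (ε := 1) fun i => by simp [Family.entry]
  rwa [one_smul] at h

/-- The classical groups have no proper normal subgroup that contains the torus elements of order
two. -/
theorem eq_top_of_signElement_mem
    (hn : (X = .C ∧ 2 ≤ n) ∨ (X = .B ∧ 2 ≤ n) ∨ (X = .D ∧ 4 ≤ n)) {K : Subgroup (G X n)} [K.Normal]
    (h : ∀ {k : Fin (X.dim n)} (hk : k ≠ k.rev), (signElement hk).1 ∈ K) : K = ⊤ := by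
  rcases hn with ⟨rfl, hn⟩ | ⟨rfl, hn⟩ | ⟨rfl, hn⟩
  · exact eq_top_of_symplectic (i := ⟨0, by omega⟩) (j := ⟨1, by omega⟩) (by simp) (h _)
  · exact eq_top_of_orthogonal form_B_transpose (by simp only [Family.dim]; omega)
      (coordIndex_ne_rev ⟨0, by omega⟩ ⟨0, by omega⟩) (entry_coordIndex_B _)
      (entry_coordIndex_rev_B _) (h _)
  · exact eq_top_of_orthogonal form_D_transpose (by simp only [Family.dim]; omega)
      (coordIndex_ne_rev ⟨0, by omega⟩ ⟨0, by omega⟩) rfl rfl (h _)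

end Normal

end ClassicalGroups

theorem lemma6p8 (X : ClassicalGroups.Family) (n : ℕ)
    (hn : (X = .C ∧ 2 ≤ n) ∨ (X = .B ∧ 2 ≤ n) ∨ (X = .D ∧ 4 ≤ n))
    {V : Type*} [AddCommGroup V] [Module ℂ V] [FiniteDimensional ℂ V]
    (ρ : Representation ℂ (ClassicalGroups.G X n) V)
    (hrat : ClassicalGroups.IsRational ρ) (hirr : ρ.IsIrreducible) (hnontriv : ¬ ρ.IsTrivial) :
    ClassicalGroups.torusCharacter ρ ∉ ClassicalGroups.RepPoly X n := by
  intro h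
  have hker : MonoidHom.ker ρ = ⊤ := ClassicalGroups.eq_top_of_signElement_mem hn fun hk =>
    ClassicalGroups.apply_eq_one_of_mem_RepPoly h (ClassicalGroups.signElement_mul_self hk)
  refine hnontriv ⟨fun g => ?_⟩
  have hg : g ∈ MonoidHom.ker ρ := hker ▸ Subgroup.mem_top g
  exact hg
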